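/- Let $M\ge 1$ and $K\ge 2$, let $0<a_1\le\dots\le a_K$ be weights, $d_1,\dots,d_K$ nonnegative integers and $\lambda_1\le\dots\le\lambda_M$ real numbers. Take $d_k$ copies $(k,1),\dots,(k,d_k)$ of each index $k$, put $N=\sum_k d_k$, and let $\sigma(1),\dots,\sigma(N)$ be an ordering (each copy occurring once) of all copies. Write $k(n)$ for the first entry of $\sigma(n)$. Suppose that (a) $\sum_{n=1}^N a_{k(n)}^2=\sum_{m=1}^M\lambda_m$; (b) $a_{K-1}^2+a_K^2\le\lambda_1$; (c) whenever $\ell<\ell'$ and $k(\ell)=k(\ell')$ (two repetitions of the same weight), $\sum_{n=\ell}^{\ell'-1}a_{k(n)}^2\ge 2\lambda_M$. Run the spectral tetris construction with reordering (STC/STR) on this ordering and on $(\lambda_1,\dots,\lambda_M)$. That is, start with the cursor in row $m=1$ and repeat the following, where $x$ is the current value of the $m$-th eigenvalue, $p$ is the weight of the first copy not yet used and $q$ the weight of the copy next to it, and $e_1,\dots,e_M$ is the standard basis of $\mathbb{R}^M$: * if $p^2\le x$, give the first copy the vector $p\,e_m$ and replace $x$ by $x-p^2$; * if $p^2>x>q^2$,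 interchange the two copies, give the copy of weight $q$ (now first) the vector $q\,e_m$, and replace $x$ by $x-q^2$; * if $p^2>x$ and $q^2\ge x$, put $y=p^2+q^2-x$, give the two copies the vectors $$\sqrt{\tfrac{x(p^2-y)}{x-y}}\,e_m+\sqrt{\tfrac{y(x-p^2)}{x-y}}\,e_{m+1},\qquad \sqrt{\tfrac{x(x-p^2)}{x-y}}\,e_m-\sqrt{\tfrac{y(p^2-y)}{x-y}}\,e_{m+1},$$ subtract $y$ from the $(m+1)$-st eigenvalue, set the $m$-th to $0$, and move the cursor to row $m+1$; the cursor moves on to the next row as soon as the current eigenvalue of its row is $0$. Then this procedure runs to completion: it uses up all the copies and all $M$ rows, and so gives a vector $f_{k,j}\in\mathbb{R}^M$ to every copy $(k,j)$. With $W_k=\operatorname{span}\{f_{k,j}:1\le j\le d_k\}$, for every $k$ the family $\{f_{k,j}\}_{j=1}^{d_k}$ is a tight frame for $W_k$ with frame bound $a_k^2$ and $\dim W_k=d_k$. Moreover $\{W_k,a_k\}_{k=1}^K$ is a fusion frame for $\mathbb{R}^M$, that is, there are $0<A\le B<\infty$ with $A\|v\|^2\le\sum_k a_k^2\|P_kv\|^2\le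 B\|v\|^2$ for all $v\in\mathbb{R}^M$, where $P_k$ is the orthogonal projection onto $W_k$. Its fusion frame operator $\sum_{k=1}^K a_k^2P_k$ has the eigenvalues $\lambda_1,\dots,\lambda_M$, counted with multiplicity. -/

import Mathlib

/-!
Conventions. Everything lives in `EuclideanSpace ℝ (Fin M)`. Rows and columns are numbered from `0`,
so that `λ₁ ≤ ⋯ ≤ λ_M` is a monotone function on `Fin M` and `a₁ ≤ ⋯ ≤ a_K` one on `Fin K`.
-/

namespace SpectralTetris

noncomputable section

/-- The standard basis vector `e_m` of `ℝ^M`. -/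
def e {M : ℕ} (m : Fin M) : EuclideanSpace ℝ (Fin M) := EuclideanSpace.single m 1

/-- First doubleton of the `2 × 2` block placed over the rows `m, m'` when the current eigenvalue of
row `m` is `x` and the two prescribed norms are `p, q`; here `y = p² + q² - x`. -/
def doubletonFst {M : ℕ} (x p q : ℝ) (m m' : Fin M) : EuclideanSpace ℝ (Fin M) :=
  if 2 * x = p ^ 2 + q ^ 2 then √(x / 2) • (e m + e m')
  else
    let y := p ^ 2 + q ^ 2 - x
    √(x * (p ^ 2 - y) / (x - y)) • e m + √(y * (x - p ^ 2) / (x - y)) • e m'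

/-- Second doubleton of the same block. -/
def doubletonSnd {M : ℕ} (x p q : ℝ) (m m' : Fin M) : EuclideanSpace ℝ (Fin M) :=
  if 2 * x = p ^ 2 + q ^ 2 then √(x / 2) • (e m - e m')
  else
    let y := p ^ 2 + q ^ 2 - x
    √(x * (x - p ^ 2) / (x - y)) • e m - √(y * (p ^ 2 - y) / (x - y)) • e m'

/-- The end of the inner loop: row `m` is left as soon as its current eigenvalue is used up. -/
def nextRow {M : ℕ} (lam : Fin M → ℝ) (m : Fin M) : ℕ :=
  if lam m = 0 then m + 1 else m

/-- The spectral tetris construction with the reordering procedure (STC/STR).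

`w i` is the prescribed norm of the vector with name `i`, `lam` is the current array of
eigenvalues, `m` is the row of the cursor, and the list holds the names still to be served, in their
current order (its head is at the column of the cursor). The result is the list of named vectors
built from here on, in the order of their columns; `none` means that the construction breaks down
(it runs out of vectors or of rows before the other is exhausted). One call is one pass through the
inner loop, with `i`, `j` the current and the next name:

* `w i ^ 2 ≤ lam m`: insert the singleton `w i • e m`;
* otherwise, if `w j ^ 2 < lam m`: interchange `i` and `j`, and insert the singleton `w j • e m`;
* otherwise insert the two doubletons of a block over the rows `m`, `m + 1`. -/
def stcStr {ι : Type*} {M : ℕ} (w : ι → ℝ) :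
    (Fin M → ℝ) → ℕ → List ι → Option (List (ι × EuclideanSpace ℝ (Fin M)))
  | _, m, [] => if m = M then some [] else none
  | lam, m, i :: l =>
    if hm : m < M then
      let r : Fin M := ⟨m, hm⟩
      if w i ^ 2 ≤ lam r then
        let lam' := Function.update lam r (lam r - w i ^ 2)
        (stcStr w lam' (nextRow lam' r) l).map ((i, w i • e r) :: ·)
      else
        match l with
        | [] => none
        | j :: l' =>
          if w j ^ 2 < lam r then
            let lam' := Function.update lam r (lam r - w j ^ 2)
            (stcStr w lam' (nextRow lam' r) (i :: l')).map ((j, w j • e r) :: ·)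
          else if hm' : m + 1 < M then
            let r' : Fin M := ⟨m + 1, hm'⟩
            let x := lam r
            let y := w i ^ 2 + w j ^ 2 - x
            let lam' := Function.update (Function.update lam r' (lam r' - y)) r 0
            (stcStr w lam' (nextRow lam' r') l').map fun out =>
              (i, doubletonFst x (w i) (w j) r r') :: (j, doubletonSnd x (w i) (w j) r r') :: out
          else none
    else none
  termination_by _ _ l => l.length

/-- STC/STR, run from the first row and the first column on the ordering `σ` of the names and the
eigenvalues `lam`, completes and assigns to each name `i` the vector `f i`; here `τ` is the final
ordering of the names, so `f (τ n)` is the `n`-th column of the resulting synthesis matrix. -/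
def Constructs {ι : Type*} {M N : ℕ} (w : ι → ℝ) (lam : Fin M → ℝ) (σ : Fin N ≃ ι)
    (f : ι → EuclideanSpace ℝ (Fin M)) : Prop :=
  ∃ τ : Fin N ≃ ι, stcStr w lam 0 (List.ofFn σ) = some (List.ofFn fun n => (τ n, f (τ n)))

/-- `{f j}` is a tight frame for the subspace `W` with frame bound `c`. -/
def IsTightFrameFor {ι E : Type*} [Fintype ι] [NormedAddCommGroup E] [InnerProductSpace ℝ E]
    (f : ι → E) (W : Submodule ℝ E) (c : ℝ) : Prop :=
  (∀ j, f j ∈ W) ∧ 0 < c ∧ ∀ x ∈ W, ∑ j, inner ℝ x (f j) ^ 2 = c * ‖x‖ ^ 2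

/-- `{W k, v k}` is a fusion frame for `E`. -/
def IsFusionFrame {κ E : Type*} [Fintype κ] [NormedAddCommGroup E] [InnerProductSpace ℝ E]
    [FiniteDimensional ℝ E] (W : κ → Submodule ℝ E) (v : κ → ℝ) : Prop :=
  (∀ k, 0 < v k) ∧ ∃ A B : ℝ, 0 < A ∧ A ≤ B ∧ ∀ x : E,
    A * ‖x‖ ^ 2 ≤ ∑ k, v k ^ 2 * ‖(W k).starProjection x‖ ^ 2 ∧
    ∑ k, v k ^ 2 * ‖(W k).starProjection x‖ ^ 2 ≤ B * ‖x‖ ^ 2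

/-- The fusion frame operator `S = ∑ₖ vₖ² Pₖ`. -/
def fusionFrameOperator {κ E : Type*} [Fintype κ] [NormedAddCommGroup E] [InnerProductSpace ℝ E]
    [FiniteDimensional ℝ E] (W : κ → Submodule ℝ E) (v : κ → ℝ) : E →L[ℝ] E :=
  ∑ k, v k ^ 2 • (W k).starProjection

/-- The self-adjoint operator `S` has the eigenvalues `lam m`, counted with multiplicity. -/
def HasSpectrum {M : ℕ} (S : EuclideanSpace ℝ (Fin M) →L[ℝ] EuclideanSpace ℝ (Fin M))
    (lam : Fin M → ℝ) : Prop :=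
  ∃ b : OrthonormalBasis (Fin M) ℝ (EuclideanSpace ℝ (Fin M)), ∀ m, S (b m) = lam m • b m

end

end SpectralTetris

/-! Give copy `i` the inclusive sum `T i` of squared weights up to `i` in the original ordering, and
let `Λ m` be the sum of the first `m` eigenvalues. With `c` the least eigenvalue, every vector built
satisfies a locality estimate: a nonzero coordinate in row `r` forces `Λ r < T i < Λ (r + 1) + c`.
Two copies of one weight meeting in row `r` would thus have `T`-values less than `lam r + c` apart,
hence less than twice the largest eigenvalue, against condition (c). Copies of equal weight
therefore have disjoint supports, so they are orthogonal of norm `a k`, and `a k ^ 2 • P k` is the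
frame operator of the `k`-th family. Summed over `k`, this is the frame operator of all the vectors,
which the construction makes diagonal with entries `lam`.

Completion and locality come from one induction along the run (`exists_isOutput`). An interchange
delays only the head of the list. A delayed copy stays too large for its row, so it waits for the
block that closes the row, and the later partial sums are unaffected. Two copies that meet in an
interchange or a block are less than `2 * c` apart in `T`, so by (c) their weights have different
indices, and by (b) their squares add up to at most `c`. A block therefore never overdraws the next
row. -/

namespace SpectralTetris

/-! ### The algebra of a `2 × 2` block. -/

section Block

/-- The coefficients of a `2 × 2` block and their defining relations. -/
theorem exists_doubleton_coeffs {M : ℕ} {x p q : ℝ} (hx : 0 < x) (hp : x < p ^ 2) (hq : x ≤ q ^ 2)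
    (m m' : Fin M) :
    ∃ α β γ δ : ℝ, doubletonFst x p q m m' = α • e m + β • e m' ∧
      doubletonSnd x p q m m' = γ • e m - δ • e m' ∧
      α ^ 2 + β ^ 2 = p ^ 2 ∧ γ ^ 2 + δ ^ 2 = q ^ 2 ∧ α ^ 2 + γ ^ 2 = x ∧
      β ^ 2 + δ ^ 2 = p ^ 2 + q ^ 2 - x ∧ α * β = γ * δ := by
  -- Blocks are only inserted when `x < p ^ 2` and `x ≤ q ^ 2`, so `x < y` and the degenerate branch
  -- `x = y` never occurs.
  have hne : ¬ 2 * x = p ^ 2 + q ^ 2 := by intro h; linarith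
  have hd : x - (p ^ 2 + q ^ 2 - x) < 0 := by linarith
  have hy : 0 < p ^ 2 + q ^ 2 - x := by linarith
  have hpy : p ^ 2 - (p ^ 2 + q ^ 2 - x) ≤ 0 := by linarith
  have hxp : x - p ^ 2 ≤ 0 := by linarith
  simp only [doubletonFst, doubletonSnd, if_neg hne]
  have ha := div_nonneg_of_nonpos (mul_nonpos_of_nonneg_of_nonpos hx.le hpy) hd.le
  have hb := div_nonneg_of_nonpos (mul_nonpos_of_nonneg_of_nonpos hy.le hxp) hd.le
  have hc := div_nonneg_of_nonpos (mul_nonpos_of_nonneg_of_nonpos hx.le hxp) hd.le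
  have he := div_nonneg_of_nonpos (mul_nonpos_of_nonneg_of_nonpos hy.le hpy) hd.le
  refine ⟨_, _, _, _, rfl, rfl, ?_, ?_, ?_, ?_, ?_⟩
  · rw [Real.sq_sqrt ha, Real.sq_sqrt hb]; field_simp [hd.ne]; ring
  · rw [Real.sq_sqrt hc, Real.sq_sqrt he]; field_simp [hd.ne]; ring
  · rw [Real.sq_sqrt ha, Real.sq_sqrt hc]; field_simp [hd.ne]; ring
  · rw [Real.sq_sqrt hb, Real.sq_sqrt he]; field_simp [hd.ne]; ring
  · rw [← Real.sqrt_mul ha, ← Real.sqrt_mul hc]; congr 1; ring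

theorem e_apply {M : ℕ} (m r : Fin M) : (e m) r = if r = m then (1 : ℝ) else 0 := by
  simp [e]

theorem norm_sq_smul_e {M : ℕ} (c : ℝ) (m : Fin M) : ‖c • e m‖ ^ 2 = c ^ 2 := by
  simp [e, norm_smul]

theorem norm_sq_add_e {M : ℕ} (α β : ℝ) {m m' : Fin M} (h : m ≠ m') :
    ‖α • e m + β • e m'‖ ^ 2 = α ^ 2 + β ^ 2 := by
  have : inner ℝ (α • e m) (β • e m') = 0 := by
    simp [e, inner_smul_left, inner_smul_right, EuclideanSpace.inner_single_left, h]
  rw [norm_add_sq_real, this, norm_sq_smul_e, norm_sq_smul_e]; ring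

theorem block_mul_add_mul {M : ℕ} {α β γ δ : ℝ} (h : α * β = γ * δ) {m m' : Fin M} (hm : m ≠ m')
    (r s : Fin M) :
    (α • e m + β • e m') r * (α • e m + β • e m') s
      + (γ • e m - δ • e m') r * (γ • e m - δ • e m') s =
    if r = s then (if r = m then α ^ 2 + γ ^ 2 else if r = m' then β ^ 2 + δ ^ 2 else 0) else 0 := by
  simp only [PiLp.add_apply, PiLp.sub_apply, PiLp.smul_apply, e_apply, smul_eq_mul]
  split_ifs <;> subst_vars <;> simp_all <;> linarith

end Block

/-! ### Invariants of the run. -/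

/-- `T` is the inclusive partial sum of the squared weights along the list, starting from `c`. -/
def IsPartialSum {ι : Type*} (w T : ι → ℝ) : ℝ → List ι → Prop
  | _, [] => True
  | c, i :: l => T i = c + w i ^ 2 ∧ IsPartialSum w T (T i) l

theorem isPartialSum_ofFn {ι : Type*} (w T : ι → ℝ) : ∀ {N : ℕ} (c : ℝ) (g : Fin N → ι),
    (∀ n, T (g n) = c + ∑ k, if k ≤ n then w (g k) ^ 2 else 0) →
      IsPartialSum w T c (List.ofFn g)
  | 0, _, _, _ => by simp [IsPartialSum]
  | N + 1, c, g, h => by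
    rw [List.ofFn_succ]
    have h0 : T (g 0) = c + w (g 0) ^ 2 := by
      rw [h 0, Fin.sum_univ_succ]; simp
    refine ⟨h0, isPartialSum_ofFn w T _ _ fun n => ?_⟩
    rw [h n.succ, Fin.sum_univ_succ, h0]; simp [add_assoc]

/-- What is used about weights and eigenvalues: `c` is a lower bound of the eigenvalues, `Λ` their
partial sums, `T` the inclusive partial sums of the squared weights in the original ordering. -/
structure Admissible {ι : Type*} {M : ℕ} (w T : ι → ℝ) (lam : Fin M → ℝ) (Λ : ℕ → ℝ) (c : ℝ) :
    Prop where
  pos : 0 < c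
  sq_pos : ∀ i, 0 < w i ^ 2
  sq_lt : ∀ i, w i ^ 2 < c
  le_lam : ∀ r, c ≤ lam r
  succ : ∀ r : Fin M, Λ (r + 1) = Λ r + lam r
  pair : ∀ i j, T i < T j → T j - T i < 2 * c → w i ^ 2 + w j ^ 2 ≤ c

/-- The head of the list has either not been delayed, or it has been delayed in row `m`. Here `C` is
the sum of the squared weights used so far. -/
def HeadInv {ι : Type*} (w T : ι → ℝ) (Λ : ℕ → ℝ) (C : ℝ) (m : ℕ) : List ι → Prop
  | [] => True
  | i :: l => IsPartialSum w T (C + w i ^ 2) l ∧ (T i = C + w i ^ 2 ∨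
      (Λ (m + 1) < C + w i ^ 2 ∧ Λ (m + 1) < T i ∧ T i ≤ C + w i ^ 2))

theorem IsPartialSum.headInv {ι : Type*} {w T : ι → ℝ} {C : ℝ} {l : List ι}
    (h : IsPartialSum w T C l) (Λ : ℕ → ℝ) (m : ℕ) : HeadInv w T Λ C m l := by
  cases l with
  | nil => trivial
  | cons i l => exact ⟨h.1 ▸ h.2, Or.inl h.1⟩

/-- The properties of the current eigenvalues `mu` in row `m`. -/
structure RowInv {M : ℕ} (lam : Fin M → ℝ) (Λ : ℕ → ℝ) (C : ℝ) (m : ℕ) (mu : Fin M → ℝ) :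
    Prop where
  le : m ≤ M
  cur : ∀ h : m < M, mu ⟨m, h⟩ = Λ (m + 1) - C
  lower : Λ m ≤ C
  upper : m < M → C < Λ (m + 1)
  final : m = M → C = Λ M
  later : ∀ r : Fin M, m < r → mu r = lam r

/-- The properties of the list of vectors built from the eigenvalues `mu` and the list `L`. -/
structure IsOutput {ι : Type*} {M : ℕ} (w T : ι → ℝ) (Λ : ℕ → ℝ) (c : ℝ)
    (mu : Fin M → ℝ) (m : ℕ) (L : List ι) (out : List (ι × EuclideanSpace ℝ (Fin M))) : Prop where
  perm : (out.map Prod.fst).Perm L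
  norm : ∀ p ∈ out, ‖p.2‖ ^ 2 = w p.1 ^ 2
  touch : ∀ p ∈ out, ∀ r : Fin M, p.2 r ≠ 0 → Λ r < T p.1 ∧ T p.1 < Λ (r + 1) + c
  frame : ∀ r s : Fin M, (out.map fun p => p.2 r * p.2 s).sum =
    if r = s then (if m ≤ r then mu r else 0) else 0

variable {ι : Type*} {M : ℕ} {w T : ι → ℝ} {lam : Fin M → ℝ} {Λ : ℕ → ℝ} {c : ℝ}

theorem Admissible.lt_succ (H : Admissible w T lam Λ c) {m : ℕ} (hm : m < M) :
    Λ m + c ≤ Λ (m + 1) := by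
  have h1 := H.succ ⟨m, hm⟩
  have h2 := H.le_lam ⟨m, hm⟩
  simp only at h1
  linarith

theorem Admissible.mono (H : Admissible w T lam Λ c) {m n : ℕ} (hmn : m ≤ n) (hn : n ≤ M) :
    Λ m ≤ Λ n := by
  induction n, hmn using Nat.le_induction with
  | base => exact le_rfl
  | succ n hmn ih =>
    have := ih (by omega)
    have := H.lt_succ (m := n) (by omega)
    have := H.pos
    linarith

theorem sum_sq_nonneg (w : ι → ℝ) (l : List ι) : 0 ≤ (l.map fun i => w i ^ 2).sum :=
  List.sum_nonneg (by simp only [List.mem_map]; rintro _ ⟨i, _, rfl⟩; positivity)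

theorem RowInv.nextRow (H : Admissible w T lam Λ c) {C C' : ℝ} {m : ℕ} (hm : m < M)
    {mu mu' : Fin M → ℝ} (R : RowInv lam Λ C m mu) (hC : C ≤ C') (hC' : C' ≤ Λ (m + 1))
    (h1 : mu' ⟨m, hm⟩ = Λ (m + 1) - C') (h2 : ∀ r : Fin M, m < r → mu' r = lam r) :
    RowInv lam Λ C' (nextRow mu' ⟨m, hm⟩) mu' := by
  have hlow := R.lower
  unfold SpectralTetris.nextRow
  split_ifs with h0
  · have hCe : C' = Λ (m + 1) := by rw [h1] at h0; linarith
    refine ⟨hm, fun h => ?_, hCe.ge, fun h => ?_, fun h => ?_, fun r hr => ?_⟩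
    · have h3 := H.succ ⟨m + 1, h⟩
      rw [h2 _ (by simp), hCe]
      simp only at h3 ⊢
      linarith
    · have := H.lt_succ h
      have := H.pos
      simp only
      linarith
    · simp only at h; rw [hCe, h]
    · simp only at hr; exact h2 r (by omega)
  · refine ⟨hm.le, fun h => h1, ?_, fun _ => ?_, fun h => ?_, fun r hr => h2 r hr⟩
    · simp only; linarith
    -- The cursor stays only if the eigenvalue is nonzero, which makes the upper bound strict.
    · exact lt_of_le_of_ne hC' fun h => h0 (by rw [h1, h]; ring)
    · simp only at h; omega

/-- Adding a singleton in row `m` to the vectors built afterwards. -/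
theorem IsOutput.cons {mu : Fin M → ℝ} {m : ℕ} (hm : m < M) {L L' : List ι} {i : ι}
    {out : List (ι × EuclideanSpace ℝ (Fin M))} {mu' : Fin M → ℝ}
    (hmu : mu' = Function.update mu ⟨m, hm⟩ (mu ⟨m, hm⟩ - w i ^ 2))
    (O : IsOutput w T Λ c mu' (nextRow mu' ⟨m, hm⟩) L' out) (hL : (i :: L').Perm L)
    (h1 : Λ m < T i) (h2 : T i < Λ (m + 1) + c) :
    IsOutput w T Λ c mu m L ((i, w i • e ⟨m, hm⟩) :: out) := by
  have hr0 : mu' ⟨m, hm⟩ = mu ⟨m, hm⟩ - w i ^ 2 := by simp [hmu]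
  have hr1 : ∀ r : Fin M, r ≠ ⟨m, hm⟩ → mu' r = mu r := fun r hr => by
    rw [hmu, Function.update_of_ne hr]
  refine ⟨?_, ?_, ?_, ?_⟩
  · exact (List.Perm.cons i O.perm).trans hL
  · simp only [List.mem_cons, forall_eq_or_imp]
    exact ⟨norm_sq_smul_e _ _, O.norm⟩
  · simp only [List.mem_cons, forall_eq_or_imp]
    refine ⟨fun r hr => ?_, O.touch⟩
    have : r = ⟨m, hm⟩ := by
      by_contra h
      exact hr (by simp [e_apply, h])
    subst this
    exact ⟨h1, h2⟩
  · intro r s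
    simp only [List.map_cons, List.sum_cons, O.frame, PiLp.smul_apply, e_apply, smul_eq_mul]
    by_cases hrs : r = s
    · subst hrs
      by_cases hr : r = ⟨m, hm⟩
      · subst hr
        unfold nextRow
        by_cases h0 : mu' ⟨m, hm⟩ = 0
        · simp [h0]; linarith
        · simp [h0]; linarith
      · have hr' : (r : ℕ) ≠ m := fun h => hr (Fin.ext h)
        have : nextRow mu' ⟨m, hm⟩ ≤ (r : ℕ) ↔ m ≤ r := by
          unfold nextRow; split_ifs <;> simp only; omega
        simp [hr, this, hr1 r hr]
    · by_cases hr : r = ⟨m, hm⟩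
      · have : ¬ s = ⟨m, hm⟩ := fun h => hrs (hr.trans h.symm)
        simp [hrs, this]
      · simp [hrs, hr]

/-- Adding a block over the rows `m`, `m + 1` to the vectors built afterwards. -/
theorem IsOutput.cons_cons {mu : Fin M → ℝ} {m : ℕ} (hm : m < M) (hm' : m + 1 < M)
    {L : List ι} {i j : ι} {out : List (ι × EuclideanSpace ℝ (Fin M))} {mu' : Fin M → ℝ}
    (hx : 0 < mu ⟨m, hm⟩) (hi : mu ⟨m, hm⟩ < w i ^ 2) (hj : mu ⟨m, hm⟩ ≤ w j ^ 2)
    (hmu : mu' = Function.update (Function.update mu ⟨m + 1, hm'⟩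
      (mu ⟨m + 1, hm'⟩ - (w i ^ 2 + w j ^ 2 - mu ⟨m, hm⟩))) ⟨m, hm⟩ 0)
    (O : IsOutput w T Λ c mu' (m + 1) L out)
    (hΛ : Λ m ≤ Λ (m + 1)) (hΛ' : Λ (m + 1) ≤ Λ (m + 2))
    (hTi : Λ (m + 1) < T i) (hTi' : T i < Λ (m + 1) + c)
    (hTj : Λ (m + 1) < T j) (hTj' : T j < Λ (m + 1) + c) :
    IsOutput w T Λ c mu m (i :: j :: L)
      ((i, doubletonFst (mu ⟨m, hm⟩) (w i) (w j) ⟨m, hm⟩ ⟨m + 1, hm'⟩) ::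
        (j, doubletonSnd (mu ⟨m, hm⟩) (w i) (w j) ⟨m, hm⟩ ⟨m + 1, hm'⟩) :: out) := by
  obtain ⟨α, β, γ, δ, hf, hs, hαβ, hγδ, hαγ, hβδ, hort⟩ :=
    exists_doubleton_coeffs hx hi hj ⟨m, hm⟩ (⟨m + 1, hm'⟩ : Fin M)
  have hne : (⟨m, hm⟩ : Fin M) ≠ ⟨m + 1, hm'⟩ := by simp
  rw [hf, hs]
  have key : ∀ t : ℝ, Λ (m + 1) < t → t < Λ (m + 1) + c → ∀ r : Fin M,
      (r = ⟨m, hm⟩ ∨ r = ⟨m + 1, hm'⟩) → Λ r < t ∧ t < Λ (r + 1) + c := by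
    -- The interval from `Λ (m + 1)` to `Λ (m + 1) + c` lies in the locality windows of both rows of
    -- the block.
    rintro t h1 h2 r (rfl | rfl)
    · exact ⟨hΛ.trans_lt h1, h2⟩
    · exact ⟨h1, h2.trans_le (by simp only; linarith [show Λ (m + 1 + 1) = Λ (m + 2) from rfl])⟩
  refine ⟨?_, ?_, ?_, ?_⟩
  · exact (O.perm.cons j).cons i
  · simp only [List.mem_cons, forall_eq_or_imp]
    refine ⟨by rw [norm_sq_add_e _ _ hne, hαβ], ?_, O.norm⟩
    rw [sub_eq_add_neg, ← neg_smul, norm_sq_add_e _ _ hne, neg_sq, hγδ]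
  · simp only [List.mem_cons, forall_eq_or_imp]
    refine ⟨fun r hr => key _ hTi hTi' r ?_, fun r hr => key _ hTj hTj' r ?_, O.touch⟩
    all_goals
      by_contra h
      rw [not_or] at h
      exact hr (by simp [e_apply, h.1, h.2])
  · intro r s
    simp only [List.map_cons, List.sum_cons, O.frame]
    rw [← add_assoc, block_mul_add_mul hort hne, hαγ, hβδ]
    by_cases hrs : r = s
    · subst hrs
      by_cases hr : r = ⟨m, hm⟩
      · subst hr; simp
      by_cases hr' : r = ⟨m + 1, hm'⟩
      · subst hr'; simp [hmu]
      · have h1 : (r : ℕ) ≠ m := fun h => hr (Fin.ext h)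
        have : m + 1 ≤ (r : ℕ) ↔ m ≤ r := by omega
        simp [hr, hr', hmu, this]
    · simp [hrs]

/-- Induction on the number of copies left, following the three moves. The trace condition, in the
form `C + ∑ = Λ M`, ensures that copies and rows run out together. -/
theorem exists_isOutput (H : Admissible w T lam Λ c) (n : ℕ) :
    ∀ (L : List ι), L.length < n → ∀ (C : ℝ) (m : ℕ) (mu : Fin M → ℝ), RowInv lam Λ C m mu →
      HeadInv w T Λ C m L → C + (L.map fun i => w i ^ 2).sum = Λ M →
      ∃ out, stcStr w mu m L = some out ∧ IsOutput w T Λ c mu m L out := by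
  induction n with
  | zero => exact fun L hn => absurd hn (Nat.not_lt_zero _)
  | succ n ih =>
  intro L hn C m mu R hL hsum
  cases L with
  | nil =>
    have hm : m = M := by
      by_contra h
      have hlt := lt_of_le_of_ne R.le h
      have := R.upper hlt
      have := H.mono (show m + 1 ≤ M from hlt) le_rfl
      simp at hsum
      linarith
    refine ⟨[], by simp [stcStr, hm], by simp, by simp, by simp, fun r s => ?_⟩
    have : ¬ m ≤ (r : ℕ) := by omega
    simp [this]
  | cons i l =>
  have hm : m < M := by
    by_contra h
    have := R.final (le_antisymm R.le (not_lt.mp h))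
    have := H.sq_pos i
    have := sum_sq_nonneg w l
    simp only [List.map_cons, List.sum_cons] at hsum
    linarith
  obtain ⟨hl, hT⟩ := hL
  have hcur := R.cur hm
  have hlow := R.lower
  have hup := R.upper hm
  have hi0 := H.sq_pos i
  have hic := H.sq_lt i
  simp only [List.map_cons, List.sum_cons] at hsum
  simp only [List.length_cons, Nat.add_lt_add_iff_right] at hn
  rw [stcStr.eq_2, dif_pos hm]
  by_cases hle : w i ^ 2 ≤ mu ⟨m, hm⟩
  · simp only [if_pos hle]
    set mu' := Function.update mu ⟨m, hm⟩ (mu ⟨m, hm⟩ - w i ^ 2) with hmu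
    have hTi : T i = C + w i ^ 2 := by
      rcases hT with h | h
      · exact h
      · linarith [h.1]
    obtain ⟨out, ho, O⟩ := ih l hn (C + w i ^ 2) (nextRow mu' ⟨m, hm⟩) mu'
      (R.nextRow H hm (by linarith) (by linarith) (by simp [hmu]; linarith)
        (fun r hr => by
          rw [hmu, Function.update_of_ne (by rintro rfl; simp at hr), R.later r hr]))
      (hl.headInv _ _) (by linarith)
    exact ⟨_, by rw [ho]; rfl, O.cons hm hmu (List.Perm.refl _) (by linarith) (by linarith)⟩
  · simp only [if_neg hle]
    rw [not_le] at hle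
    have hTi : Λ (m + 1) < T i := by
      rcases hT with h | h
      · linarith
      · exact h.2.1
    have hTi' : T i ≤ C + w i ^ 2 := by
      rcases hT with h | h
      · exact h.le
      · exact h.2.2
    -- A lone last copy exceeding row `m` contradicts the trace: either it overshoots the last row,
    -- or, being less than `c`, it cannot fill row `m + 1`.
    cases l with
    | nil =>
      simp only [List.map_nil, List.sum_nil] at hsum
      by_cases hm' : m + 1 < M
      · have h1 := H.lt_succ hm'
        have h2 := H.mono (show m + 1 + 1 ≤ M from hm') le_rfl
        linarith
      · obtain rfl : M = m + 1 := by omega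
        linarith
    | cons j l =>
    obtain ⟨hTj, hl⟩ := hl
    have hj0 := H.sq_pos j
    have hjc := H.sq_lt j
    -- `T j = C + w i ^ 2 + w j ^ 2` is less than `Λ (m + 1) + 2 * c`, while `T i` already exceeds
    -- `Λ (m + 1)`.
    have hij := H.pair i j (by linarith) (by linarith)
    simp only [List.map_cons, List.sum_cons] at hsum
    simp only
    by_cases hlt : w j ^ 2 < mu ⟨m, hm⟩
    · simp only [if_pos hlt]
      set mu' := Function.update mu ⟨m, hm⟩ (mu ⟨m, hm⟩ - w j ^ 2) with hmu
      -- The strict inequality in the interchange test keeps the cursor in row `m`, where the delay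
      -- of `i` is recorded.
      have hnr : nextRow mu' ⟨m, hm⟩ = m := by
        have : mu' ⟨m, hm⟩ ≠ 0 := by simp [hmu]; linarith
        simp [nextRow, this]
      obtain ⟨out, ho, O⟩ := ih (i :: l) (by simpa using hn) (C + w j ^ 2)
        (nextRow mu' ⟨m, hm⟩) mu'
        (R.nextRow H hm (by linarith) (by linarith) (by simp [hmu]; linarith)
          (fun r hr => by
            rw [hmu, Function.update_of_ne (by rintro rfl; simp at hr), R.later r hr]))
        (by
          rw [hnr]
          refine ⟨?_, Or.inr ⟨by linarith, hTi, by linarith⟩⟩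
          convert hl using 1
          linarith)
        (by simp only [List.map_cons, List.sum_cons]; linarith)
      exact ⟨_, by rw [ho]; rfl, O.cons hm hmu (List.Perm.swap _ _ _) (by linarith) (by linarith)⟩
    · simp only [if_neg hlt]
      rw [not_lt] at hlt
      have hm' : m + 1 < M := by
        by_contra h
        obtain rfl : M = m + 1 := by omega
        have := sum_sq_nonneg w l
        linarith
      have h1 := H.lt_succ hm'
      have h2 := H.succ ⟨m + 1, hm'⟩
      have h3 := R.later ⟨m + 1, hm'⟩ (by simp)
      simp only at h2
      simp only [dif_pos hm']
      set mu' := Function.update (Function.update mu ⟨m + 1, hm'⟩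
        (mu ⟨m + 1, hm'⟩ - (w i ^ 2 + w j ^ 2 - mu ⟨m, hm⟩))) ⟨m, hm⟩ 0 with hmu
      -- `y = w i ^ 2 + w j ^ 2 - x < c` because `x > 0`, so row `m + 1` keeps a positive remainder.
      have hnr : nextRow mu' ⟨m + 1, hm'⟩ = m + 1 := by
        have : mu' ⟨m + 1, hm'⟩ ≠ 0 := by simp [hmu]; linarith
        simp [nextRow, this]
      obtain ⟨out, ho, O⟩ := ih l (by simp at hn; omega) (C + w i ^ 2 + w j ^ 2) (m + 1) mu'
        ⟨hm'.le, fun _ => by simp [hmu]; linarith, by linarith, fun _ => by linarith,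
          fun h => by omega,
          fun r hr => by
            rw [hmu, Function.update_of_ne (by rintro rfl; simp at hr),
              Function.update_of_ne (by rintro rfl; simp at hr), R.later r (by omega)]⟩
        (by rw [← hTj]; exact hl.headInv _ _) (by linarith)
      exact ⟨_, by rw [hnr, ho]; rfl, O.cons_cons hm hm' (by linarith) hle hlt hmu
        (by linarith [H.lt_succ hm]) (by linarith) hTi (by linarith) (by linarith) (by linarith)⟩

/-! ### Orthogonal families of equal norm. -/

section LinearAlgebra

variable {J E : Type*} [Fintype J] [NormedAddCommGroup E] [InnerProductSpace ℝ E]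
  [FiniteDimensional ℝ E]

/-- After division by `√c` the family is orthonormal, so its frame operator is `c` times the
projection onto its span. -/
theorem smul_starProjection_span [DecidableEq J] {f : J → E} {c : ℝ} (hc : 0 < c)
    (hf : ∀ i j, inner ℝ (f i) (f j) = if i = j then c else 0) (x : E) :
    c • (Submodule.span ℝ (Set.range f)).starProjection x = ∑ j, inner ℝ (f j) x • f j := by
  rw [← eq_inv_smul_iff₀ hc.ne']
  refine Submodule.eq_starProjection_of_mem_orthogonal ?_ ?_
  · exact Submodule.smul_mem _ _ (Submodule.sum_mem _ fun j _ =>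
      Submodule.smul_mem _ _ (Submodule.subset_span ⟨j, rfl⟩))
  · rw [Submodule.mem_orthogonal]
    intro u hu
    induction hu using Submodule.span_induction with
    | mem u hu =>
      obtain ⟨i, rfl⟩ := hu
      simp [inner_sub_right, inner_smul_right, inner_sum, hf]
      field_simp
      ring
    | zero => simp
    | add u v _ _ hu hv => rw [inner_add_left, hu, hv, add_zero]
    | smul t u _ hu => rw [inner_smul_left, hu, mul_zero]

theorem smul_norm_sq_starProjection_span [DecidableEq J] {f : J → E} {c : ℝ} (hc : 0 < c)
    (hf : ∀ i j, inner ℝ (f i) (f j) = if i = j then c else 0) (x : E) :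
    c * ‖(Submodule.span ℝ (Set.range f)).starProjection x‖ ^ 2 = ∑ j, inner ℝ (f j) x ^ 2 := by
  set W := Submodule.span ℝ (Set.range f)
  have h : ‖W.starProjection x‖ ^ 2 = inner ℝ (W.starProjection x) x := by
    rw [← real_inner_self_eq_norm_sq, Submodule.inner_starProjection_left_eq_right,
      Submodule.starProjection_eq_self_iff.mpr (W.starProjection_apply_mem x),
      ← Submodule.inner_starProjection_left_eq_right]
  rw [h, ← real_inner_smul_left, smul_starProjection_span hc hf, sum_inner]
  exact Finset.sum_congr rfl fun j _ => by rw [real_inner_smul_left, sq]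

theorem isTightFrameFor_span [DecidableEq J] {f : J → E} {c : ℝ} (hc : 0 < c)
    (hf : ∀ i j, inner ℝ (f i) (f j) = if i = j then c else 0) :
    IsTightFrameFor f (Submodule.span ℝ (Set.range f)) c := by
  refine ⟨fun j => Submodule.subset_span ⟨j, rfl⟩, hc, fun x hx => ?_⟩
  have h := smul_norm_sq_starProjection_span hc hf x
  rw [Submodule.starProjection_eq_self_iff.mpr hx] at h
  rw [h]
  exact Finset.sum_congr rfl fun j _ => by rw [real_inner_comm]

end LinearAlgebra

theorem finrank_span_of_orthogonal {J E : Type*} [Fintype J] [NormedAddCommGroup E]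
    [InnerProductSpace ℝ E] [DecidableEq J] {f : J → E} {c : ℝ} (hc : 0 < c)
    (hf : ∀ i j, inner ℝ (f i) (f j) = if i = j then c else 0) :
    Module.finrank ℝ (Submodule.span ℝ (Set.range f)) = Fintype.card J := by
  refine finrank_span_eq_card (linearIndependent_of_ne_zero_of_inner_eq_zero (𝕜 := ℝ) ?_ ?_)
  · intro i hi
    have := hf i i
    simp [hi] at this
    exact hc.ne this
  · intro i j hij
    simpa [hij] using hf i j

/-! ### The fusion frame operator as the frame operator of all the vectors. -/

section FusionFrame

variable {K M : ℕ} {d : Fin K → ℕ} {a : Fin K → ℝ}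
  {f : (Σ k : Fin K, Fin (d k)) → EuclideanSpace ℝ (Fin M)} {lam : Fin M → ℝ}

theorem fusionFrameOperator_apply_e (a_pos : ∀ k, 0 < a k)
    (hf : ∀ k i j, inner ℝ (f ⟨k, i⟩) (f ⟨k, j⟩) = if i = j then a k ^ 2 else 0)
    (hrow : ∀ r s, ∑ i, f i r * f i s = if r = s then lam r else 0) (m : Fin M) :
    fusionFrameOperator (fun k => Submodule.span ℝ (Set.range fun j => f ⟨k, j⟩)) a (e m) =
      lam m • e m := by
  simp only [fusionFrameOperator, _root_.sum_apply, _root_.smul_apply]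
  rw [Finset.sum_congr rfl fun k _ => smul_starProjection_span (pow_pos (a_pos k) 2) (hf k) (e m),
    ← Fintype.sum_sigma' (fun k j => inner ℝ (f ⟨k, j⟩) (e m) • f ⟨k, j⟩)]
  ext r
  have := hrow m r
  simp only [e, EuclideanSpace.inner_single_right, one_mul]
  simp [this, eq_comm]

theorem sum_norm_sq_starProjection (a_pos : ∀ k, 0 < a k)
    (hf : ∀ k i j, inner ℝ (f ⟨k, i⟩) (f ⟨k, j⟩) = if i = j then a k ^ 2 else 0)
    (hrow : ∀ r s, ∑ i, f i r * f i s = if r = s then lam r else 0)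
    (x : EuclideanSpace ℝ (Fin M)) :
    ∑ k, a k ^ 2 * ‖(Submodule.span ℝ (Set.range fun j => f ⟨k, j⟩)).starProjection x‖ ^ 2 =
      ∑ m, lam m * x m ^ 2 := by
  rw [Finset.sum_congr rfl fun k _ =>
    smul_norm_sq_starProjection_span (pow_pos (a_pos k) 2) (hf k) x,
    ← Fintype.sum_sigma' (fun k j => inner ℝ (f ⟨k, j⟩) x ^ 2)]
  calc ∑ i, inner ℝ (f i) x ^ 2
      = ∑ i, ∑ r, ∑ s, f i r * f i s * (x r * x s) := by
        refine Finset.sum_congr rfl fun i _ => ?_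
        rw [PiLp.inner_apply, sq, Finset.sum_mul_sum]
        refine Finset.sum_congr rfl fun r _ => Finset.sum_congr rfl fun s _ => ?_
        simp; ring
    _ = ∑ r, ∑ s, (∑ i, f i r * f i s) * (x r * x s) := by
        rw [Finset.sum_comm]
        refine Finset.sum_congr rfl fun r _ => ?_
        rw [Finset.sum_comm]
        simp only [Finset.sum_mul]
    _ = ∑ m, lam m * x m ^ 2 := by
        simp [hrow, sq]

theorem isFusionFrame_of_frame_diagonal (a_pos : ∀ k, 0 < a k) {bot top : Fin M}
    (lam_pos : 0 < lam bot) (hbot : ∀ r, lam bot ≤ lam r) (htop : ∀ r, lam r ≤ lam top)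
    (hf : ∀ k i j, inner ℝ (f ⟨k, i⟩) (f ⟨k, j⟩) = if i = j then a k ^ 2 else 0)
    (hrow : ∀ r s, ∑ i, f i r * f i s = if r = s then lam r else 0) :
    IsFusionFrame (fun k => Submodule.span ℝ (Set.range fun j => f ⟨k, j⟩)) a := by
  refine ⟨a_pos, lam bot, lam top, lam_pos, hbot top, fun x => ?_⟩
  rw [sum_norm_sq_starProjection a_pos hf hrow, EuclideanSpace.real_norm_sq_eq, Finset.mul_sum,
    Finset.mul_sum]
  refine ⟨Finset.sum_le_sum fun m _ => ?_, Finset.sum_le_sum fun m _ => ?_⟩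
  · exact mul_le_mul_of_nonneg_right (hbot m) (sq_nonneg _)
  · exact mul_le_mul_of_nonneg_right (htop m) (sq_nonneg _)

theorem hasSpectrum_of_apply_e {S : EuclideanSpace ℝ (Fin M) →L[ℝ] EuclideanSpace ℝ (Fin M)}
    (h : ∀ m, S (e m) = lam m • e m) : HasSpectrum S lam :=
  ⟨EuclideanSpace.basisFun (Fin M) ℝ, fun m => by simpa [e] using h m⟩

end FusionFrame

/-- A list of named vectors in which the names are a rearrangement of `σ` is read off as a family. -/
theorem exists_family_of_perm {ι E : Type*} {N : ℕ} (σ : Fin N ≃ ι) (out : List (ι × E))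
    (h : (out.map Prod.fst).Perm (List.ofFn σ)) :
    ∃ (f : ι → E) (τ : Fin N ≃ ι), out = List.ofFn fun n => (τ n, f (τ n)) := by
  have hlen : out.length = N := by simpa using h.length_eq
  subst hlen
  have hnd : (out.map Prod.fst).Nodup := h.nodup_iff.mpr (List.nodup_ofFn.mpr σ.injective)
  have hinj : Function.Injective fun n : Fin out.length => (out.get n).1 := by
    intro m n hmn
    have := (List.nodup_iff_injective_get.mp hnd) (a₁ := ⟨m, by simp⟩) (a₂ := ⟨n, by simp⟩)
      (by simpa using hmn)
    simpa [Fin.ext_iff] using this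
  have hbij : Function.Bijective fun n : Fin out.length => (out.get n).1 := by
    have : Function.Bijective fun n : Fin out.length => σ.symm (out.get n).1 :=
      Finite.injective_iff_bijective.mp (σ.symm.injective.comp hinj)
    simpa [Function.comp_def] using σ.bijective.comp this
  refine ⟨fun i => (out.get ((Equiv.ofBijective _ hbij).symm i)).2, Equiv.ofBijective _ hbij, ?_⟩
  conv_lhs => rw [← List.ofFn_get out]
  congr 1
  funext n
  simp only [Equiv.symm_apply_apply]
  rfl

/-! ### The hypotheses in terms of partial sums. -/

section Assembly

variable {M K N : ℕ} {a : Fin K → ℝ} {d : Fin K → ℕ} {lam : Fin M → ℝ}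

/-- The inclusive partial sums of the squared weights in the ordering `σ`. -/
noncomputable def partialSum {ι : Type*} (w : ι → ℝ) (σ : Fin N ≃ ι) (i : ι) : ℝ :=
  ∑ n ∈ Finset.Iic (σ.symm i), w (σ n) ^ 2

theorem partialSum_mono {ι : Type*} (w : ι → ℝ) (σ : Fin N ≃ ι) {i j : ι}
    (h : σ.symm i ≤ σ.symm j) : partialSum w σ i ≤ partialSum w σ j :=
  Finset.sum_le_sum_of_subset_of_nonneg (Finset.Iic_subset_Iic.mpr h) fun _ _ _ => sq_nonneg _

/-- The difference of inclusive sums runs over the positions after `i` up to `j`; equality of the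
two weights shifts it to the half-open range of condition (c). -/
theorem partialSum_sub {ι : Type*} (w : ι → ℝ) (σ : Fin N ≃ ι) {i j : ι}
    (h : σ.symm i ≤ σ.symm j) (hw : w i = w j) :
    partialSum w σ j - partialSum w σ i =
      ∑ n ∈ Finset.Ico (σ.symm i) (σ.symm j), w (σ n) ^ 2 := by
  have key : ∀ i, partialSum w σ i = ∑ n ∈ Finset.Iio (σ.symm i), w (σ n) ^ 2 + w i ^ 2 := by
    intro i
    rw [partialSum, ← Finset.Iio_insert, Finset.sum_insert (by simp), Equiv.apply_symm_apply,
      add_comm]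
  have hu : Finset.Iio (σ.symm j) =
      Finset.Iio (σ.symm i) ∪ Finset.Ico (σ.symm i) (σ.symm j) := by
    ext n; simp only [Finset.mem_union, Finset.mem_Iio, Finset.mem_Ico]; omega
  have hd : Disjoint (Finset.Iio (σ.symm i)) (Finset.Ico (σ.symm i) (σ.symm j)) := by
    rw [Finset.disjoint_left]; simp only [Finset.mem_Iio, Finset.mem_Ico]; omega
  rw [key, key, hu, Finset.sum_union hd, hw]
  ring

theorem isPartialSum_partialSum {ι : Type*} (w : ι → ℝ) (σ : Fin N ≃ ι) :
    IsPartialSum w (partialSum w σ) 0 (List.ofFn σ) := by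
  refine isPartialSum_ofFn _ _ _ _ fun n => ?_
  rw [partialSum, Equiv.symm_apply_apply, zero_add, ← Finset.sum_filter]
  congr 1
  ext; simp

/-- The partial sums of the eigenvalues. -/
noncomputable def eigenSum (lam : Fin M → ℝ) (m : ℕ) : ℝ :=
  ∑ r ∈ Finset.univ.filter (fun r : Fin M => (r : ℕ) < m), lam r

theorem eigenSum_succ (lam : Fin M → ℝ) (r : Fin M) :
    eigenSum lam (r + 1) = eigenSum lam r + lam r := by
  have : Finset.univ.filter (fun s : Fin M => (s : ℕ) < r + 1) =
      insert r (Finset.univ.filter fun s : Fin M => (s : ℕ) < r) := by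
    ext s; simp [Fin.ext_iff]; omega
  rw [eigenSum, this, Finset.sum_insert (by simp), add_comm, eigenSum]

theorem add_sq_le_of_ne (a_pos : ∀ k, 0 < a k) (a_mono : Monotone a) {k₁ k₂ : Fin K}
    (h₁ : (k₁ : ℕ) = K - 2) (h₂ : (k₂ : ℕ) = K - 1) {k k' : Fin K} (h : k ≠ k') :
    a k ^ 2 + a k' ^ 2 ≤ a k₁ ^ 2 + a k₂ ^ 2 := by
  wlog hlt : k < k' generalizing k k'
  · rw [add_comm]
    exact this h.symm (lt_of_le_of_ne (not_lt.mp hlt) h.symm)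
  have := pow_le_pow_left₀ (a_pos k).le (a_mono (show k ≤ k₁ by omega)) 2
  have := pow_le_pow_left₀ (a_pos k').le (a_mono (show k' ≤ k₂ by omega)) 2
  linarith

theorem admissible (a_pos : ∀ k, 0 < a k) (a_mono : Monotone a) {k₁ k₂ : Fin K}
    (h₁ : (k₁ : ℕ) = K - 2) (h₂ : (k₂ : ℕ) = K - 1) {bot top : Fin M}
    (hbot : ∀ r, lam bot ≤ lam r) (σ : Fin N ≃ (Σ k : Fin K, Fin (d k)))
    (two_le : a k₁ ^ 2 + a k₂ ^ 2 ≤ lam bot)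
    (spread : ∀ l l' : Fin N, l < l' → (σ l).1 = (σ l').1 →
      2 * lam top ≤ ∑ n ∈ Finset.Ico l l', a (σ n).1 ^ 2) :
    Admissible (fun i => a i.1) (partialSum (fun i => a i.1) σ) lam (eigenSum lam)
      (lam bot) := by
  have hpos₁ := pow_pos (a_pos k₁) 2
  have hpos₂ := pow_pos (a_pos k₂) 2
  refine ⟨by linarith, fun i => pow_pos (a_pos _) 2, fun i => ?_, hbot, eigenSum_succ lam,
    fun i j hT hc => ?_⟩
  · have := pow_le_pow_left₀ (a_pos i.1).le (a_mono (show i.1 ≤ k₂ by omega)) 2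
    linarith
  · have hlt : σ.symm i < σ.symm j := by
      by_contra h
      exact absurd hT (not_lt.mpr (partialSum_mono _ σ (not_lt.mp h)))
    -- Equal indices would force a gap of at least `2 * lam top ≥ 2 * lam bot`.
    refine (add_sq_le_of_ne a_pos a_mono h₁ h₂ fun hij => ?_).trans two_le
    have h3 := spread _ _ hlt (by simpa using hij)
    have h4 := partialSum_sub (fun i : (Σ k : Fin K, Fin (d k)) => a i.1) σ hlt.le (by simp [hij])
    have := hbot top
    linarith

end Assembly

end SpectralTetris

theorem mainTheorem3 {M K N : ℕ} (hM : 1 ≤ M) (hK : 2 ≤ K)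
    (a : Fin K → ℝ) (a_pos : ∀ k, 0 < a k) (a_mono : Monotone a)
    (d : Fin K → ℕ)
    (lam : Fin M → ℝ) (lam_mono : Monotone lam)
    (σ : Fin N ≃ (Σ k : Fin K, Fin (d k)))
    (trace_eq : ∑ n, a (σ n).1 ^ 2 = ∑ m, lam m)
    (two_le : a ⟨K - 2, by omega⟩ ^ 2 + a ⟨K - 1, by omega⟩ ^ 2 ≤ lam ⟨0, by omega⟩)
    (spread : ∀ l l' : Fin N, l < l' → (σ l).1 = (σ l').1 →
      2 * lam ⟨M - 1, by omega⟩ ≤ ∑ n ∈ Finset.Ico l l', a (σ n).1 ^ 2) :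
    ∃ f : (Σ k : Fin K, Fin (d k)) → EuclideanSpace ℝ (Fin M),
      SpectralTetris.Constructs (fun i => a i.1) lam σ f ∧
      ∃ W : Fin K → Submodule ℝ (EuclideanSpace ℝ (Fin M)),
        (∀ k, W k = Submodule.span ℝ (Set.range fun j => f ⟨k, j⟩)) ∧
        (∀ k, SpectralTetris.IsTightFrameFor (fun j => f ⟨k, j⟩) (W k) (a k ^ 2)) ∧
        (∀ k, Module.finrank ℝ (W k) = d k) ∧
        SpectralTetris.IsFusionFrame W a ∧
        SpectralTetris.HasSpectrum (SpectralTetris.fusionFrameOperator W a) lam := by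
  open SpectralTetris in
  have hbot : ∀ r, lam ⟨0, by omega⟩ ≤ lam r := fun r =>
    lam_mono (Fin.mk_le_mk.mpr (Nat.zero_le _))
  have htop : ∀ r, lam r ≤ lam ⟨M - 1, by omega⟩ := fun r =>
    lam_mono (Fin.le_def.mpr (by simp only; omega))
  have H := admissible a_pos a_mono rfl rfl hbot σ two_le spread
  set w : (Σ k : Fin K, Fin (d k)) → ℝ := fun i => a i.1 with hw
  set T := partialSum w σ
  set Λ := eigenSum lam with hΛ
  have hΛ0 : Λ 0 = 0 := by simp [hΛ, eigenSum]
  have hΛM : Λ M = ∑ m, lam m := by simp [hΛ, eigenSum]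
  have hΛ1 := H.succ ⟨0, by omega⟩
  simp only [hΛ0, zero_add] at hΛ1
  have R : RowInv lam Λ 0 0 lam := ⟨Nat.zero_le _, fun h => by simp [hΛ1], hΛ0.le,
    fun _ => by rw [zero_add, hΛ1]; exact H.pos, fun h => by omega, fun _ _ => rfl⟩
  obtain ⟨out, hout, O⟩ := exists_isOutput H (N + 1) (List.ofFn σ) (by simp) 0 0 lam R
    ((isPartialSum_partialSum w σ).headInv _ _)
    (by rw [hΛM, ← trace_eq, List.map_ofFn, List.sum_ofFn]; simp [hw])
  obtain ⟨f, τ, rfl⟩ := exists_family_of_perm σ out O.perm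
  have hnorm : ∀ i, ‖f i‖ ^ 2 = w i ^ 2 := fun i =>
    O.norm (i, f i) (List.mem_ofFn.mpr ⟨τ.symm i, by simp⟩)
  have htouch : ∀ i, ∀ r : Fin M, f i r ≠ 0 →
      Λ r < T i ∧ T i < Λ (r + 1) + lam ⟨0, by omega⟩ := fun i =>
    O.touch (i, f i) (List.mem_ofFn.mpr ⟨τ.symm i, by simp⟩)
  have hrow : ∀ r s, ∑ i, f i r * f i s = if r = s then lam r else 0 := by
    intro r s
    have := O.frame r s
    rw [List.map_ofFn, List.sum_ofFn] at this
    rw [← Equiv.sum_comp τ]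
    simpa using this
  have hdisj : ∀ k, ∀ i j : Fin (d k), σ.symm ⟨k, i⟩ < σ.symm ⟨k, j⟩ → ∀ r,
      f ⟨k, i⟩ r = 0 ∨ f ⟨k, j⟩ r = 0 := by
    -- A common row `r` would give a gap below `lam r + lam 0`, at most twice the largest
    -- eigenvalue, contradicting `spread`.
    intro k i j hij r
    by_contra! h
    have h1 := (htouch _ r h.1).1
    have h2 := (htouch _ r h.2).2
    have h3 := spread _ _ hij (by simp)
    have h4 := partialSum_sub w σ hij.le rfl
    have h5 := htop ⟨0, by omega⟩
    have h6 := htop r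
    have h7 := H.succ r
    simp only [hw] at h4
    linarith
  have hf : ∀ k i j, inner ℝ (f ⟨k, i⟩) (f ⟨k, j⟩) = if i = j then a k ^ 2 else 0 := by
    intro k i j
    split_ifs with hij
    · rw [hij, real_inner_self_eq_norm_sq, hnorm]
    · rw [PiLp.inner_apply]
      refine Finset.sum_eq_zero fun r _ => ?_
      have hne : σ.symm ⟨k, i⟩ ≠ σ.symm ⟨k, j⟩ := fun h => hij (by simpa using h)
      rcases lt_or_gt_of_ne hne with h | h
      · rcases hdisj k i j h r with h | h <;> simp [h]
      · rcases hdisj k j i h r with h | h <;> simp [h]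
  have ha : ∀ k, 0 < a k ^ 2 := fun k => pow_pos (a_pos k) 2
  exact ⟨f, ⟨τ, hout⟩, _, fun k => rfl, fun k => isTightFrameFor_span (ha k) (hf k),
    fun k => by rw [finrank_span_of_orthogonal (ha k) (hf k), Fintype.card_fin],
    isFusionFrame_of_frame_diagonal a_pos H.pos hbot htop hf hrow,
    hasSpectrum_of_apply_e (fusionFrameOperator_apply_e a_pos hf hrow)⟩
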